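/- For a real $n\times d$ matrix $A$ and an integer $k\ge 0$ let $f_k(A)=\min\{\|A-X\|_F : X\in\mathbb{R}^{n\times d},\ \mathrm{rank}(X)\le k\}$. For $0<\varepsilon<1$, call an $m\times n$ matrix $P$ an $\varepsilon$-subspace embedding for the column space of $A$ if $$(1-\varepsilon)\|Ax\|_2\le\|PAx\|_2\le(1+\varepsilon)\|Ax\|_2\qquad\text{for all }x\in\mathbb{R}^d.$$ A $d\times k$ matrix $V$ consists of top-$k$ right singular vectors of a matrix $M$ with $d$ columns if its columns $v_1,\dots,v_k$ are orthonormal and $M^TMv_i=\sigma_i^2v_i$, where $\sigma_1\ge\sigma_2\ge\dots\ge\sigma_d\ge 0$ are the singular values of $M$ counted with multiplicity (so $VV^T$ is the orthogonal projection onto the span of $v_1,\dots,v_k$; ties may be broken arbitrarily). **Theorem.** (1) For every $\varepsilon_0\in(0,1)$ there is a constant $C>0$, depending only on $\varepsilon_0$, such that for all $m,n,d,k$, all $0<\varepsilon\le\varepsilon_0$, every $n\times d$ matrix $A$, every $m\times n$ matrix $P$ that is an $\varepsilon$-subspace embedding for the column space of $A$, and every $d\times k$ matrix $V$ of top-$k$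 right singular vectors of $PA$, $$\|A-AVV^T\|_F\le(1+C\varepsilon)\,f_k(A).$$ (2) There are absolute constants $K>0$ and $L\in\mathbb{N}$, $L\geq 1$, and for every $\varepsilon_0\in(0,1)$ a constant $C>0$ depending only on $\varepsilon_0$, such that the following holds for all $m,n,d,q$ and all $0<\varepsilon\le\varepsilon_0$ with $m\ge Kd/\varepsilon^2$ and $q\ge Ld$. Let $A$ be a fixed $n\times d$ matrix and let $P$ be a random $m\times n$ matrix whose entries are uniform in $\{-1/\sqrt m,1/\sqrt m\}$ and $q$-wise independent (any at most $q$ distinct entries are mutually independent). Then with probability at least $1-e^{-d}$, $P$ is an $\varepsilon$-subspace embedding for the column space of $A$ and, simultaneously for all $k$ and all $d\times k$ matrices $V$ of top-$k$ right singular vectors of $PA$, $\|A-AVV^T\|_F\le(1+C\varepsilon)f_k(A)$. -/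

import Mathlib

open Matrix MeasureTheory ProbabilityTheory
open scoped Matrix.Norms.Frobenius

/-- The distance `f_k(A) = min {‖A - X‖_F : rank X ≤ k}` from `A` to the matrices of rank at most
`k`.  Matrix norms are Frobenius norms throughout. -/
noncomputable def lowRankDist {n d : ℕ} (k : ℕ) (A : Matrix (Fin n) (Fin d) ℝ) : ℝ :=
  sInf {r : ℝ | ∃ X : Matrix (Fin n) (Fin d) ℝ, X.rank ≤ k ∧ r = ‖A - X‖}

/-- `P` is a subspace embedding for the column space of `A` with distortion `1 ± ε`
(Euclidean norms). -/
def IsSubspaceEmbedding {m n d : ℕ} (ε : ℝ) (P : Matrix (Fin m) (Fin n) ℝ)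
    (A : Matrix (Fin n) (Fin d) ℝ) : Prop :=
  ∀ x : EuclideanSpace ℝ (Fin d),
    (1 - ε) * ‖toEuclideanLin A x‖ ≤ ‖toEuclideanLin (P * A) x‖ ∧
      ‖toEuclideanLin (P * A) x‖ ≤ (1 + ε) * ‖toEuclideanLin A x‖

/-- The columns of `V` are top `k` right singular vectors of `M`: they are orthonormal, and the
`i`-th column is a right singular vector for the `i`-th largest singular value `σ_i` of `M`
(counted with multiplicity), that is, `MᵀM v_i = σ_i² v_i`.  Ties, and the vectors for singular
value `0`, may be chosen in any way; `k ≤ d` is forced by orthonormality. -/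
def IsTopRightSingularVectors {m d k : ℕ} (M : Matrix (Fin m) (Fin d) ℝ)
    (V : Matrix (Fin d) (Fin k) ℝ) : Prop :=
  Vᵀ * V = 1 ∧
    ∀ i : Fin k, (Mᵀ * M) *ᵥ V.col i = ((toEuclideanLin M).singularValues i) ^ 2 • V.col i

/-- `P` is a random `m × n` sign matrix: each entry is uniform in `{-1/√m, 1/√m}`, and the entries
are `q`-wise independent, i.e. any at most `q` distinct entries are mutually independent. -/
structure IsRandomSignMatrix {Ω : Type*} [MeasurableSpace Ω] (μ : Measure Ω) (q : ℕ) {m n : ℕ}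
    (P : Ω → Matrix (Fin m) (Fin n) ℝ) : Prop where
  measurable_entry : ∀ i j, Measurable fun ω => P ω i j
  pos_entry : ∀ i j, μ {ω | P ω i j = 1 / √(m : ℝ)} = 1 / 2
  neg_entry : ∀ i j, μ {ω | P ω i j = -(1 / √(m : ℝ))} = 1 / 2
  indep : ∀ S : Finset (Fin m × Fin n), S.card ≤ q →
    iIndepFun (fun (s : S) ω => P ω s.1.1 s.1.2) μ

/-! Part (1) is deterministic. The Frobenius norm is read off column by column, so an embedding
distorts `‖A * R‖` by at most `1 ± ε` for every `R`. By Ky Fan, `V * Vᵀ` is optimal for `P * A`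
among projections of trace at most `k`, and any competitor `X` may be replaced by `A * Q`, with `Q`
the projection onto the row space of `X`. Comparing the two projections through `P` loses a factor
`(1 + ε) / (1 - ε) = 1 + 2ε / (1 - ε)`.

For part (2) only the embedding property is random. For a unit vector `y`, the `2d`-th moment of `‖P
y‖² - 1` is the expectation of a polynomial of degree at most `4d` in the entries, so `4d`-wise
independence gives the value for fully independent signs (`integral_eval_eq_expect_sign`). That
value is bounded through exponential moments (`expect_mean_signSum_sq_pow_le`), and Markov gives a
tail bound. A net of at most `5 ^ d` points in the range of `A`, with polarisation over pairs of net
points, extends it to the whole range. -/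

/-! ### Ky Fan's principle and Frobenius norms. -/

theorem Antitone.sum_mul_le_sum_range {lam : ℕ → ℝ} (hanti : Antitone lam) (hnn : ∀ i, 0 ≤ lam i)
    {d k : ℕ} {w : Fin d → ℝ} (hw0 : ∀ i, 0 ≤ w i) (hw1 : ∀ i, w i ≤ 1) (hk : ∑ i, w i ≤ k) :
    ∑ i : Fin d, lam i * w i ≤ ∑ i ∈ Finset.range k, lam i := by
  -- After subtracting `lam k`, terms below `k` are nonnegative and the rest nonpositive, so `0 ≤ w
  -- ≤ 1` bounds each one separately.
  have h1 : ∑ i : Fin d, lam i * w i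
      = ∑ i : Fin d, (lam i - lam k) * w i + lam k * ∑ i, w i := by
    rw [Finset.mul_sum, ← Finset.sum_add_distrib]
    exact Finset.sum_congr rfl fun i _ => by ring
  have h2 : ∑ i : Fin d, (lam i - lam k) * w i
      ≤ ∑ i : Fin d, (if (i : ℕ) < k then lam i - lam k else 0) := by
    refine Finset.sum_le_sum fun i _ => ?_
    split_ifs with h
    · have := hanti h.le
      nlinarith [hw1 i]
    · have := hanti (not_lt.mp h)
      nlinarith [hw0 i]
  have h3 : ∑ i : Fin d, (if (i : ℕ) < k then lam i - lam k else 0)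
      ≤ ∑ i ∈ Finset.range k, (lam i - lam k) := by
    rw [Fin.sum_univ_eq_sum_range (fun i => if i < k then lam i - lam k else 0) d,
      ← Finset.sum_filter]
    refine Finset.sum_le_sum_of_subset_of_nonneg (fun i hi => ?_) fun i hi _ => ?_
    · simp only [Finset.mem_filter] at hi
      simpa using hi.2
    · have := hanti (Finset.mem_range.mp hi).le
      linarith
  have h4 : ∑ i ∈ Finset.range k, (lam i - lam k) = ∑ i ∈ Finset.range k, lam i - k * lam k := by
    simp [Finset.sum_sub_distrib]
  nlinarith [hnn k]

namespace Matrix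

variable {m n d k : ℕ}

theorem toEuclideanLin_mul (A : Matrix (Fin m) (Fin n) ℝ) (B : Matrix (Fin n) (Fin d) ℝ) :
    toEuclideanLin (A * B) = toEuclideanLin A ∘ₗ toEuclideanLin B := by
  ext x : 1
  simp [toLpLin_apply, mulVec_mulVec]

theorem trace_toEuclideanLin (A : Matrix (Fin n) (Fin n) ℝ) :
    LinearMap.trace ℝ _ (toEuclideanLin A) = A.trace := by
  rw [toEuclideanLin_eq_toLin_orthonormal,
    LinearMap.trace_eq_matrix_trace ℝ (EuclideanSpace.basisFun (Fin n) ℝ).toBasis,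
    LinearMap.toMatrix_toLin]

theorem toEuclideanLin_transpose (A : Matrix (Fin m) (Fin n) ℝ) :
    toEuclideanLin Aᵀ = (toEuclideanLin A).adjoint := by
  rw [← toEuclideanLin_conjTranspose_eq_adjoint, conjTranspose_eq_transpose_of_trivial]

theorem frobenius_norm_sq (A : Matrix (Fin m) (Fin n) ℝ) : ‖A‖ ^ 2 = ∑ i, ∑ j, A i j ^ 2 := by
  rw [frobenius_norm_def, ← Real.sqrt_eq_rpow, Real.sq_sqrt (by positivity)]
  simp

theorem frobenius_norm_sq_eq_trace (A : Matrix (Fin m) (Fin n) ℝ) :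
    ‖A‖ ^ 2 = (Aᵀ * A).trace := by
  rw [frobenius_norm_sq, Finset.sum_comm]
  simp [trace, mul_apply, sq]

theorem frobenius_norm_sq_eq_sum_col (A : Matrix (Fin m) (Fin n) ℝ) :
    ‖A‖ ^ 2 = ∑ j, ‖toEuclideanLin A (EuclideanSpace.single j 1)‖ ^ 2 := by
  rw [frobenius_norm_sq, Finset.sum_comm]
  simp [EuclideanSpace.norm_sq_eq, toLpLin_apply]

theorem frobenius_norm_le_of_toEuclideanLin {p : ℕ} {A : Matrix (Fin m) (Fin d) ℝ}
    {B : Matrix (Fin p) (Fin d) ℝ} {c : ℝ} (hc : 0 ≤ c)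
    (h : ∀ x, ‖toEuclideanLin A x‖ ≤ c * ‖toEuclideanLin B x‖) : ‖A‖ ≤ c * ‖B‖ := by
  refine le_of_sq_le_sq ?_ (by positivity)
  rw [mul_pow, frobenius_norm_sq_eq_sum_col, frobenius_norm_sq_eq_sum_col, Finset.mul_sum]
  refine Finset.sum_le_sum fun j _ => ?_
  rw [← mul_pow]
  exact pow_le_pow_left₀ (norm_nonneg _) (h _) 2

/-- A matrix of rank at most `k` is fixed by an orthogonal projection of trace at most `k`. -/
theorem exists_projection_mul_eq {X : Matrix (Fin n) (Fin d) ℝ} (hX : X.rank ≤ k) :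
    ∃ Q : Matrix (Fin d) (Fin d) ℝ, Qᵀ = Q ∧ Q * Q = Q ∧ X * Q = X ∧ Q.trace ≤ k := by
  let U := LinearMap.range (toEuclideanLin Xᵀ)
  let p : EuclideanSpace ℝ (Fin d) →ₗ[ℝ] EuclideanSpace ℝ (Fin d) := U.starProjection
  let Q : Matrix (Fin d) (Fin d) ℝ := toEuclideanLin.symm p
  have hp : toEuclideanLin Q = p := LinearEquiv.apply_symm_apply _ _
  have hQ : Qᵀ = Q := by
    apply (toEuclideanLin (𝕜 := ℝ) (m := Fin d) (n := Fin d)).injective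
    rw [toEuclideanLin_transpose, hp]
    exact U.starProjection_isSymmetric.adjoint_eq
  refine ⟨Q, hQ, ?_, ?_, ?_⟩
  · apply (toEuclideanLin (𝕜 := ℝ) (m := Fin d) (n := Fin d)).injective
    rw [toEuclideanLin_mul, hp]
    ext x : 1
    exact congrArg (fun f => f x) U.isIdempotentElem_starProjection.eq
  · have : Q * Xᵀ = Xᵀ := by
      apply (toEuclideanLin (𝕜 := ℝ) (m := Fin d) (n := Fin n)).injective
      rw [toEuclideanLin_mul, hp]
      ext x : 1
      exact Submodule.starProjection_eq_self_iff.mpr ⟨x, rfl⟩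
    rw [← transpose_inj, transpose_mul, hQ, this]
  · have htr : LinearMap.trace ℝ _ p = Module.finrank ℝ U := by
      refine LinearMap.IsProj.trace ⟨fun x => U.starProjection_apply_mem x, fun x hx => ?_⟩
      exact Submodule.starProjection_eq_self_iff.mpr hx
    rw [← trace_toEuclideanLin, hp, htr]
    have : Module.finrank ℝ U = X.rank := by
      rw [← rank_transpose, rank_eq_finrank_range_toLin Xᵀ
        (EuclideanSpace.basisFun (Fin d) ℝ).toBasis (EuclideanSpace.basisFun (Fin n) ℝ).toBasis,
        ← toEuclideanLin_eq_toLin_orthonormal]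
    rw [this]
    exact_mod_cast hX

/-- Pythagoras: the trace on the right is `‖M * Q‖ ^ 2`. -/
theorem norm_sub_mul_projection_sq (M : Matrix (Fin n) (Fin d) ℝ) {Q : Matrix (Fin d) (Fin d) ℝ}
    (hQ : Qᵀ = Q) (hQQ : Q * Q = Q) : ‖M - M * Q‖ ^ 2 = ‖M‖ ^ 2 - (Mᵀ * M * Q).trace := by
  have h : (M - M * Q)ᵀ * (M - M * Q) = Mᵀ * M - Mᵀ * M * Q - (Q * (Mᵀ * M) - Q * (Mᵀ * M * Q)) := by
    rw [transpose_sub, transpose_mul, hQ]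
    simp only [Matrix.sub_mul, Matrix.mul_sub, Matrix.mul_assoc]
    abel
  rw [frobenius_norm_sq_eq_trace, frobenius_norm_sq_eq_trace, h, trace_sub, trace_sub, trace_sub,
    trace_mul_comm Q (Mᵀ * M * Q), Matrix.mul_assoc (Mᵀ * M) Q Q, hQQ, trace_mul_comm Q]
  ring

/-- Ky Fan's maximum principle for `MᵀM`. -/
theorem trace_mul_projection_le (M : Matrix (Fin n) (Fin d) ℝ) {Q : Matrix (Fin d) (Fin d) ℝ}
    (hQ : Qᵀ = Q) (hQQ : Q * Q = Q) (hk : Q.trace ≤ k) :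
    (Mᵀ * M * Q).trace ≤ ∑ i ∈ Finset.range k, (toEuclideanLin M).singularValues i ^ 2 := by
  set T := toEuclideanLin M
  set p := toEuclideanLin Q with hp
  have hd : Module.finrank ℝ (EuclideanSpace ℝ (Fin d)) = d := by simp
  let b := T.isSymmetric_adjoint_comp_self.eigenvectorBasis hd
  have hpsymm : ∀ x y, inner ℝ (p x) y = inner ℝ x (p y) := fun x y => by
    rw [← LinearMap.adjoint_inner_right, hp, ← toEuclideanLin_transpose, hQ]
  have hpp : ∀ x, p (p x) = p x := fun x => by
    rw [← LinearMap.comp_apply, hp, ← toEuclideanLin_mul, hQQ]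
  have hin : ∀ x, inner ℝ x (p x) = ‖p x‖ ^ 2 := fun x => by
    rw [← hpp, ← hpsymm, hpp, real_inner_self_eq_norm_sq]
  -- In an eigenbasis of `MᵀM` the trace is a weighted sum of squared singular values. The weights
  -- `‖p (b i)‖ ^ 2` lie in `[0, 1]` and add up to the trace of `Q`.
  have h1 : (Mᵀ * M * Q).trace = ∑ i : Fin d, T.singularValues i ^ 2 * inner ℝ (b i) (p (b i)) := by
    rw [← trace_toEuclideanLin, LinearMap.trace_eq_sum_inner _ b]
    refine Finset.sum_congr rfl fun i _ => ?_
    rw [toEuclideanLin_mul, toEuclideanLin_mul, toEuclideanLin_transpose, LinearMap.comp_apply,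
      ← T.isSymmetric_adjoint_comp_self (b i)]
    rw [T.isSymmetric_adjoint_comp_self.apply_eigenvectorBasis hd i, inner_smul_left,
      T.sq_singularValues_fin hd]
    simp [b, p]
  have h2 : ∑ i, inner ℝ (b i) (p (b i)) ≤ k := by
    rwa [← LinearMap.trace_eq_sum_inner _ b, trace_toEuclideanLin]
  rw [h1]
  refine Antitone.sum_mul_le_sum_range (lam := fun i => T.singularValues i ^ 2)
    (fun i j hij => pow_le_pow_left₀ (T.singularValues_nonneg j) (T.singularValues_antitone hij) 2)
    (fun i => sq_nonneg _) (fun i => ?_) (fun i => ?_) h2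
  · rw [hin]; positivity
  · have := real_inner_le_norm (b i) (p (b i))
    rw [hin, b.orthonormal.1 i] at this
    rw [hin]
    nlinarith [norm_nonneg (p (b i))]

end Matrix

/-! ### Low-rank approximation from a subspace embedding. -/

section
variable {m n d k : ℕ}

theorem IsTopRightSingularVectors.trace_eq {M : Matrix (Fin m) (Fin d) ℝ}
    {V : Matrix (Fin d) (Fin k) ℝ} (hV : IsTopRightSingularVectors M V) :
    (Mᵀ * M * (V * Vᵀ)).trace
      = ∑ i ∈ Finset.range k, (toEuclideanLin M).singularValues i ^ 2 := by
  rw [← Matrix.mul_assoc, trace_mul_comm, trace,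
    ← Fin.sum_univ_eq_sum_range (fun i => (toEuclideanLin M).singularValues i ^ 2)]
  refine Finset.sum_congr rfl fun i _ => ?_
  have h1 : (Vᵀ * (Mᵀ * M * V)).diag i = V.col i ⬝ᵥ ((Mᵀ * M) *ᵥ V.col i) := rfl
  have h2 : V.col i ⬝ᵥ V.col i = 1 := by
    have := congrFun (congrFun hV.1 i) i
    simpa [mul_apply, dotProduct] using this
  rw [h1, hV.2, dotProduct_smul, h2, smul_eq_mul, mul_one]

theorem IsTopRightSingularVectors.norm_sub_le {M : Matrix (Fin m) (Fin d) ℝ}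
    {V : Matrix (Fin d) (Fin k) ℝ} (hV : IsTopRightSingularVectors M V)
    {Q : Matrix (Fin d) (Fin d) ℝ} (hQ : Qᵀ = Q) (hQQ : Q * Q = Q) (hk : Q.trace ≤ k) :
    ‖M - M * (V * Vᵀ)‖ ≤ ‖M - M * Q‖ := by
  refine le_of_sq_le_sq ?_ (norm_nonneg _)
  rw [norm_sub_mul_projection_sq M (by simp) (by
    rw [Matrix.mul_assoc, ← Matrix.mul_assoc Vᵀ, hV.1, Matrix.one_mul]),
    norm_sub_mul_projection_sq M hQ hQQ, hV.trace_eq]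
  linarith [trace_mul_projection_le M hQ hQQ hk]

/-- Since `X` is fixed by `Q`, the left matrix is `(A - X) * (1 - Q)`, and a projection does not
increase the norm. -/
theorem norm_sub_mul_projection_le {A X : Matrix (Fin n) (Fin d) ℝ} {Q : Matrix (Fin d) (Fin d) ℝ}
    (hQ : Qᵀ = Q) (hQQ : Q * Q = Q) (hX : X * Q = X) : ‖A - A * Q‖ ≤ ‖A - X‖ := by
  refine le_of_sq_le_sq ?_ (norm_nonneg _)
  have h : A - A * Q = (A - X) - (A - X) * Q := by
    rw [Matrix.sub_mul, hX]; abel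
  rw [h, norm_sub_mul_projection_sq _ hQ hQQ]
  have : ((A - X)ᵀ * (A - X) * Q).trace = ‖(A - X) * Q‖ ^ 2 := by
    rw [frobenius_norm_sq_eq_trace, transpose_mul, hQ, Matrix.mul_assoc Q, trace_mul_comm Q,
      Matrix.mul_assoc, Matrix.mul_assoc, Matrix.mul_assoc, hQQ]
  rw [this]
  nlinarith [sq_nonneg ‖(A - X) * Q‖]

theorem IsSubspaceEmbedding.toEuclideanLin_mul {ε : ℝ} {P : Matrix (Fin m) (Fin n) ℝ}
    {A : Matrix (Fin n) (Fin d) ℝ} (h : IsSubspaceEmbedding ε P A) (R : Matrix (Fin d) (Fin k) ℝ)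
    (x : EuclideanSpace ℝ (Fin k)) :
    (1 - ε) * ‖toEuclideanLin (A * R) x‖ ≤ ‖toEuclideanLin (P * A * R) x‖ ∧
      ‖toEuclideanLin (P * A * R) x‖ ≤ (1 + ε) * ‖toEuclideanLin (A * R) x‖ := by
  have := h (toEuclideanLin R x)
  rwa [← LinearMap.comp_apply, ← LinearMap.comp_apply, ← Matrix.toEuclideanLin_mul,
    ← Matrix.toEuclideanLin_mul] at this

theorem IsSubspaceEmbedding.norm_sub_le {ε ε₀ : ℝ} (hε : 0 < ε) (hεε₀ : ε ≤ ε₀) (hε₀ : ε₀ < 1)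
    {P : Matrix (Fin m) (Fin n) ℝ} {A : Matrix (Fin n) (Fin d) ℝ} (h : IsSubspaceEmbedding ε P A)
    {V : Matrix (Fin d) (Fin k) ℝ} (hV : IsTopRightSingularVectors (P * A) V) :
    ‖A - A * V * Vᵀ‖ ≤ (1 + 2 / (1 - ε₀) * ε) * lowRankDist k A := by
  have h1 : 0 < 1 - ε₀ := by linarith
  have h2 : 0 < 1 - ε := by linarith
  have hc : 0 < 1 + 2 / (1 - ε₀) * ε := by positivity
  rw [← div_le_iff₀' hc]
  refine le_csInf ⟨_, 0, by simp, rfl⟩ ?_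
  rintro _ ⟨X, hX, rfl⟩
  rw [div_le_iff₀' hc]
  obtain ⟨Q, hQ, hQQ, hXQ, hk⟩ := exists_projection_mul_eq hX
  have e1 : ∀ R : Matrix (Fin d) (Fin d) ℝ, A - A * R = A * (1 - R) := fun R => by
    rw [Matrix.mul_sub, Matrix.mul_one]
  have e2 : ∀ R : Matrix (Fin d) (Fin d) ℝ, P * A - P * A * R = P * A * (1 - R) := fun R => by
    rw [Matrix.mul_sub, Matrix.mul_one]
  have s1 : ‖A - A * (V * Vᵀ)‖ ≤ (1 - ε)⁻¹ * ‖P * A - P * A * (V * Vᵀ)‖ := by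
    rw [e1, e2]
    refine frobenius_norm_le_of_toEuclideanLin (by positivity) fun x => ?_
    rw [le_inv_mul_iff₀ h2]
    exact (h.toEuclideanLin_mul _ x).1
  have s2 : ‖P * A - P * A * Q‖ ≤ (1 + ε) * ‖A - A * Q‖ := by
    rw [e1, e2]
    exact frobenius_norm_le_of_toEuclideanLin (by positivity) fun x =>
      (h.toEuclideanLin_mul _ x).2
  -- The constant `C = 2 / (1 - ε₀)` comes from here.
  have s3 : (1 - ε)⁻¹ * (1 + ε) ≤ 1 + 2 / (1 - ε₀) * ε := by
    have : 2 / (1 - ε) ≤ 2 / (1 - ε₀) := by gcongr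
    calc (1 - ε)⁻¹ * (1 + ε) = 1 + 2 / (1 - ε) * ε := by field_simp; ring
      _ ≤ _ := by gcongr
  calc ‖A - A * V * Vᵀ‖ = ‖A - A * (V * Vᵀ)‖ := by rw [Matrix.mul_assoc]
    _ ≤ (1 - ε)⁻¹ * ((1 + ε) * ‖A - X‖) := by
      refine s1.trans ?_
      gcongr
      refine (hV.norm_sub_le hQ hQQ hk).trans (s2.trans ?_)
      gcongr
      exact norm_sub_mul_projection_le hQ hQQ hXQ
    _ = (1 - ε)⁻¹ * (1 + ε) * ‖A - X‖ := by ring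
    _ ≤ _ := by gcongr
end

/-! ### Moments of fully independent sign sums. -/

open scoped BigOperators

theorem Fintype.expect_pi_prod {ι α : Type*} [Fintype ι] [DecidableEq ι] [Fintype α]
    (f : ι → α → ℝ) : 𝔼 s : ι → α, ∏ i, f i (s i) = ∏ i, 𝔼 a, f i a := by
  simp only [Fintype.expect_eq_sum_div_card, Finset.prod_div_distrib, Finset.prod_univ_sum,
    Fintype.piFinset_univ, Fintype.card_pi, Finset.prod_const, Nat.cast_pow]

theorem Real.pow_two_mul_div_factorial_le_cosh (x : ℝ) (j : ℕ) :
    x ^ (2 * j) / (2 * j).factorial ≤ Real.cosh x :=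
  le_hasSum (Real.hasSum_cosh x) j fun i _ => by
    rw [pow_mul]; positivity

theorem Real.exp_le_one_add_add_sq_mul_exp_abs (x : ℝ) :
    Real.exp x ≤ 1 + x + x ^ 2 * Real.exp |x| := by
  have h := Complex.norm_exp_sub_sum_le_norm_mul_exp (x : ℂ) 2
  simp only [Finset.sum_range_succ, Finset.range_zero, Finset.sum_empty, pow_zero, pow_one,
    Nat.factorial_zero, Nat.factorial_one, Nat.cast_one, div_one, zero_add, Complex.norm_real,
    Real.norm_eq_abs, sq_abs] at h
  have h' : ‖Complex.exp (x : ℂ) - (1 + (x : ℂ))‖ = |Real.exp x - (1 + x)| := by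
    rw [← Real.norm_eq_abs, ← Complex.norm_real]
    push_cast
    rfl
  rw [h'] at h
  linarith [le_abs_self (Real.exp x - (1 + x))]

/-- The Rademacher sum with coefficients `y` and signs `r`. -/
def signSum {ι : Type*} [Fintype ι] (y : ι → ℝ) (r : ι → ℤˣ) : ℝ :=
  ∑ j, (((r j : ℤˣ) : ℤ) : ℝ) * y j

theorem expect_sign (f : ℤˣ → ℝ) : 𝔼 u, f u = (f 1 + f (-1)) / 2 := by
  rw [Fintype.expect_eq_sum_div_card, UnitsInt.univ, Finset.sum_pair (by decide)]
  simp

section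
variable {ι : Type*} [Fintype ι] [DecidableEq ι] (y : ι → ℝ)

theorem expect_exp_signSum_le (lam : ℝ) :
    𝔼 r : ι → ℤˣ, Real.exp (lam * signSum y r) ≤ Real.exp (lam ^ 2 * (∑ j, y j ^ 2) / 2) := by
  have h : ∀ r : ι → ℤˣ, Real.exp (lam * signSum y r)
      = ∏ j, (fun j (u : ℤˣ) => Real.exp (lam * (((u : ℤ) : ℝ) * y j))) j (r j) := fun r => by
    rw [signSum, Finset.mul_sum, Real.exp_sum]
  rw [(Finset.expect_congr rfl fun r _ => h r).trans (Fintype.expect_pi_prod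
    fun j (u : ℤˣ) => Real.exp (lam * (((u : ℤ) : ℝ) * y j))), Finset.mul_sum, Finset.sum_div, Real.exp_sum]
  refine Finset.prod_le_prod (fun j _ => Finset.expect_nonneg fun _ _ => (Real.exp_pos _).le)
    fun j _ => ?_
  rw [expect_sign]
  have := Real.cosh_le_exp_half_sq (lam * y j)
  rw [Real.cosh_eq] at this
  simpa [mul_pow] using this

theorem expect_sign_mul_sign (i j : ι) :
    𝔼 r : ι → ℤˣ, (((r i : ℤˣ) : ℤ) : ℝ) * (((r j : ℤˣ) : ℤ) : ℝ) = if i = j then 1 else 0 := by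
  split_ifs with h
  · subst h
    have : ∀ u : ℤˣ, ((u : ℤ) : ℝ) * ((u : ℤ) : ℝ) = 1 := fun u => by
      rcases Int.units_eq_one_or u with rfl | rfl <;> simp
    simp [this]
  · have : 𝔼 r : ι → ℤˣ, (((r i : ℤˣ) : ℤ) : ℝ) * (((r j : ℤˣ) : ℤ) : ℝ)
        = 𝔼 r : ι → ℤˣ, -((((r i : ℤˣ) : ℤ) : ℝ) * (((r j : ℤˣ) : ℤ) : ℝ)) := by
      -- Flipping the sign of coordinate `i` alone negates the product and preserves the average.
      refine Fintype.expect_equiv (Equiv.mulRight (Pi.mulSingle i (-1))) _ _ fun r => ?_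
      simp [Pi.mulSingle_eq_of_ne (Ne.symm h)]
    rw [Finset.expect_neg_distrib] at this
    linarith

theorem expect_signSum_sq : 𝔼 r : ι → ℤˣ, signSum y r ^ 2 = ∑ j, y j ^ 2 := by
  have h : ∀ r : ι → ℤˣ, signSum y r ^ 2
      = ∑ i, ∑ j, y i * y j * ((((r i : ℤˣ) : ℤ) : ℝ) * (((r j : ℤˣ) : ℤ) : ℝ)) := fun r => by
    rw [signSum, sq, Finset.sum_mul_sum]
    exact Finset.sum_congr rfl fun i _ => Finset.sum_congr rfl fun j _ => by ring
  simp only [h]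
  rw [Finset.expect_sum_comm]
  refine Finset.sum_congr rfl fun i _ => ?_
  rw [Finset.expect_sum_comm]
  simp only [← Finset.mul_expect, expect_sign_mul_sign]
  simp [sq]

variable {y} (hy : ∑ j, y j ^ 2 = 1)
include hy

/-- Bound `z ^ (2j) / (2j)!` by `cosh z` at `z = √(2j) * signSum y r`; this scale turns the
sub-Gaussian bound into `exp j`. -/
theorem expect_signSum_pow_le (j : ℕ) :
    (2 * j : ℝ) ^ j * 𝔼 r : ι → ℤˣ, signSum y r ^ (2 * j) ≤ (2 * j).factorial * Real.exp j := by
  have hf : (0 : ℝ) < (2 * j).factorial := by exact_mod_cast Nat.factorial_pos _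
  set lam := √(2 * j : ℝ)
  have hlam : lam ^ 2 = 2 * j := Real.sq_sqrt (by positivity)
  have h1 : 𝔼 r : ι → ℤˣ, (lam * signSum y r) ^ (2 * j) / (2 * j).factorial ≤ Real.exp j := by
    calc _ ≤ 𝔼 r : ι → ℤˣ, (Real.exp (lam * signSum y r) + Real.exp (-lam * signSum y r)) / 2 := by
          refine Finset.expect_le_expect fun r _ => ?_
          have := Real.pow_two_mul_div_factorial_le_cosh (lam * signSum y r) j
          rwa [Real.cosh_eq, ← neg_mul] at this
      _ = (𝔼 r : ι → ℤˣ, Real.exp (lam * signSum y r)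
            + 𝔼 r : ι → ℤˣ, Real.exp (-lam * signSum y r)) / 2 := by
          rw [← Finset.expect_add_distrib, Finset.expect_div]
      _ ≤ (Real.exp j + Real.exp j) / 2 := by
          gcongr
          · refine (expect_exp_signSum_le y lam).trans_eq ?_
            rw [hy, hlam]; congr 1; ring
          · refine (expect_exp_signSum_le y (-lam)).trans_eq ?_
            rw [hy, neg_sq, hlam]; congr 1; ring
      _ = Real.exp j := by ring
  have h2 : ∀ r : ι → ℤˣ, (lam * signSum y r) ^ (2 * j) / (2 * j).factorial
      = (2 * j : ℝ) ^ j / (2 * j).factorial * signSum y r ^ (2 * j) := fun r => by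
    rw [mul_pow, pow_mul lam, hlam]; ring
  simp only [h2] at h1
  rw [← Finset.mul_expect, div_mul_eq_mul_div, div_le_iff₀ hf] at h1
  linarith

/-- Expand the exponential. As `(2j)! ≤ j! * (2j) ^ j`, the `j`-th term is at most `(e / 4) ^ j ≤ (3
/ 4) ^ j`, and the geometric series sums to `4`. -/
theorem expect_exp_signSum_sq_le : 𝔼 r : ι → ℤˣ, Real.exp (signSum y r ^ 2 / 4) ≤ 4 := by
  have hsum : HasSum (fun j : ℕ => 𝔼 r : ι → ℤˣ, (signSum y r ^ 2 / 4) ^ j / j.factorial)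
      (𝔼 r : ι → ℤˣ, Real.exp (signSum y r ^ 2 / 4)) := by
    simp only [Fintype.expect_eq_sum_div_card]
    refine HasSum.div_const (hasSum_sum fun r _ => ?_) _
    rw [Real.exp_eq_exp_ℝ]
    exact NormedSpace.expSeries_div_hasSum_exp (signSum y r ^ 2 / 4)
  have hgeo := hasSum_geometric_of_lt_one (r := (3 / 4 : ℝ)) (by norm_num) (by norm_num)
  have hle : ∀ j : ℕ, 𝔼 r : ι → ℤˣ, (signSum y r ^ 2 / 4) ^ j / j.factorial ≤ (3 / 4 : ℝ) ^ j := by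
    intro j
    have h0 := expect_signSum_pow_le hy j
    have hj : (0 : ℝ) < (2 * j : ℝ) ^ j := by
      rcases Nat.eq_zero_or_pos j with rfl | h
      · simp
      · positivity
    have hjf : (0 : ℝ) < j.factorial := by exact_mod_cast Nat.factorial_pos _
    have hfac : ((2 * j).factorial : ℝ) ≤ j.factorial * (2 * j : ℝ) ^ j := by
      have h1 := Nat.factorial_mul_descFactorial (n := 2 * j) (k := j) (by omega)
      have h2 := Nat.descFactorial_le_pow (2 * j) j
      rw [show 2 * j - j = j by omega] at h1
      rw [← h1]
      push_cast
      gcongr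
      exact_mod_cast h2
    have h3 : 𝔼 r : ι → ℤˣ, signSum y r ^ (2 * j) ≤ j.factorial * Real.exp j := by
      refine le_of_mul_le_mul_left (h0.trans ?_) hj
      calc _ ≤ j.factorial * (2 * j : ℝ) ^ j * Real.exp j := by gcongr
        _ = _ := by ring
    have h4 : ∀ r : ι → ℤˣ, (signSum y r ^ 2 / 4) ^ j / j.factorial
        = 1 / (4 ^ j * j.factorial) * signSum y r ^ (2 * j) := fun r => by
      rw [div_pow, ← pow_mul]; field_simp
    simp only [h4]
    rw [← Finset.mul_expect]
    have h5 : Real.exp j ≤ 3 ^ j := by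
      rw [← Real.exp_one_pow]
      gcongr
      linarith [Real.exp_one_lt_d9]
    calc 1 / (4 ^ j * j.factorial) * 𝔼 r : ι → ℤˣ, signSum y r ^ (2 * j)
        ≤ 1 / (4 ^ j * j.factorial) * (j.factorial * 3 ^ j) := by
          gcongr
          exact h3.trans (by gcongr)
      _ = (3 / 4 : ℝ) ^ j := by rw [div_pow]; field_simp
  refine (hasSum_le hle hsum hgeo).trans ?_
  norm_num

/-- Second-order Taylor expansion: the linear term averages to zero because `signSum y r ^ 2` has
mean `1`. For `|u| ≤ 1 / 8` the remainder is controlled by the exponential moment just bounded, and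
`1000 = 250 * 4`. -/
theorem expect_exp_mul_signSum_sq_sub_one_le {u : ℝ} (hu : |u| ≤ 1 / 8) :
    𝔼 r : ι → ℤˣ, Real.exp (u * (signSum y r ^ 2 - 1)) ≤ Real.exp (1000 * u ^ 2) := by
  have hpt : ∀ r : ι → ℤˣ, Real.exp (u * (signSum y r ^ 2 - 1))
      ≤ 1 + u * (signSum y r ^ 2 - 1) + u ^ 2 * (250 * Real.exp (signSum y r ^ 2 / 4)) := by
    intro r
    set w := signSum y r ^ 2
    have hw : 0 ≤ w := sq_nonneg _
    have h1 := Real.exp_le_one_add_add_sq_mul_exp_abs (u * (w - 1))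
    set a := |w - 1| with ha
    have ha0 : 0 ≤ a := abs_nonneg _
    -- The square costs one `exp (a / 8)` and the Taylor remainder another; together `exp (a / 4) ≤
    -- exp ((w + 1) / 4)`.
    have h2 : (w - 1) ^ 2 ≤ 128 * Real.exp (a / 8) := by
      have := Real.pow_div_factorial_le_exp (x := a / 8) (by positivity) 2
      rw [← sq_abs, ← ha]
      norm_num at this
      linarith
    have h3 : Real.exp |u * (w - 1)| ≤ Real.exp (a / 8) := by
      rw [abs_mul]
      apply Real.exp_le_exp.mpr
      nlinarith
    have h4 : Real.exp (a / 8) * Real.exp (a / 8) ≤ 1.5 * Real.exp (w / 4) := by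
      have h5 : a ≤ w + 1 := by rw [ha, abs_le]; constructor <;> linarith
      have h6 : Real.exp (1 / 4) ≤ 1.5 := by
        have h7 : Real.exp (1 / 4) ^ 4 = Real.exp 1 := by rw [← Real.exp_nat_mul]; norm_num
        by_contra! h8
        have : (1.5 : ℝ) ^ 4 ≤ Real.exp (1 / 4) ^ 4 := by gcongr
        have := Real.exp_one_lt_d9
        norm_num at *
        linarith
      calc Real.exp (a / 8) * Real.exp (a / 8) = Real.exp (a / 4) := by
            rw [← Real.exp_add]; congr 1; ring
        _ ≤ Real.exp (1 / 4 + w / 4) := Real.exp_le_exp.mpr (by linarith)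
        _ ≤ _ := by rw [Real.exp_add]; gcongr
    have h5 : (u * (w - 1)) ^ 2 * Real.exp |u * (w - 1)| ≤ u ^ 2 * (250 * Real.exp (w / 4)) := by
      rw [mul_pow, mul_assoc]
      refine mul_le_mul_of_nonneg_left ?_ (sq_nonneg u)
      calc (w - 1) ^ 2 * Real.exp |u * (w - 1)|
          ≤ 128 * Real.exp (a / 8) * Real.exp (a / 8) := by gcongr
        _ ≤ 128 * (1.5 * Real.exp (w / 4)) := by rw [mul_assoc]; gcongr
        _ ≤ _ := by linarith [Real.exp_pos (w / 4)]
    linarith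
  calc _ ≤ 𝔼 r : ι → ℤˣ, (1 + u * (signSum y r ^ 2 - 1)
          + u ^ 2 * (250 * Real.exp (signSum y r ^ 2 / 4))) :=
        Finset.expect_le_expect fun r _ => hpt r
    _ = 1 + u ^ 2 * (250 * 𝔼 r : ι → ℤˣ, Real.exp (signSum y r ^ 2 / 4)) := by
        rw [Finset.expect_add_distrib, Finset.expect_add_distrib, ← Finset.mul_expect,
          ← Finset.mul_expect, ← Finset.mul_expect, Finset.expect_sub_distrib, expect_signSum_sq,
          hy, Fintype.expect_const, sub_self, mul_zero, add_zero]
    _ ≤ 1 + u ^ 2 * (250 * 4) := by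
        gcongr
        exact expect_exp_signSum_sq_le hy
    _ ≤ _ := by linarith [Real.add_one_le_exp (1000 * u ^ 2)]

/-- Independent rows factor the average into `m` copies of the one-row bound at `u = t / m`. -/
theorem expect_exp_mean_signSum_sq_le {m : ℕ} (hm : 0 < m) {t : ℝ} (ht : |t| ≤ m / 8) :
    𝔼 s : Fin m → ι → ℤˣ, Real.exp (t * ((m : ℝ)⁻¹ * ∑ i, signSum y (s i) ^ 2 - 1))
      ≤ Real.exp (1000 * t ^ 2 / m) := by
  have hm' : (0 : ℝ) < m := by exact_mod_cast hm
  have h : ∀ s : Fin m → ι → ℤˣ, Real.exp (t * ((m : ℝ)⁻¹ * ∑ i, signSum y (s i) ^ 2 - 1))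
      = ∏ i, (fun _ r => Real.exp (t / m * (signSum y r ^ 2 - 1))) i (s i) := fun s => by
    rw [← Real.exp_sum, ← Finset.mul_sum, Finset.sum_sub_distrib]
    simp only [Finset.sum_const, Finset.card_univ, Fintype.card_fin, nsmul_eq_mul, mul_one]
    congr 1
    field_simp
  rw [(Finset.expect_congr rfl fun s _ => h s).trans (Fintype.expect_pi_prod
    fun (_ : Fin m) (r : ι → ℤˣ) => Real.exp (t / m * (signSum y r ^ 2 - 1)))]
  have hu : |t / m| ≤ 1 / 8 := by
    rw [abs_div, abs_of_pos hm', div_le_iff₀ hm']; linarith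
  calc _ ≤ ∏ _i : Fin m, Real.exp (1000 * (t / m) ^ 2) :=
        Finset.prod_le_prod (fun _ _ => Finset.expect_nonneg fun _ _ => (Real.exp_pos _).le)
          fun _ _ => expect_exp_mul_signSum_sq_sub_one_le hy hu
    _ = _ := by
        rw [Finset.prod_const, ← Real.exp_nat_mul, Finset.card_univ, Fintype.card_fin]
        congr 1
        field_simp

theorem expect_mean_signSum_sq_pow_le {m : ℕ} (hm : 0 < m) {t : ℝ} (ht0 : 0 < t) (ht : t ≤ m / 8)
    (j : ℕ) :
    𝔼 s : Fin m → ι → ℤˣ, ((m : ℝ)⁻¹ * ∑ i, signSum y (s i) ^ 2 - 1) ^ (2 * j)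
      ≤ (2 * j).factorial / t ^ (2 * j) * Real.exp (1000 * t ^ 2 / m) := by
  have hpt : ∀ z : ℝ, z ^ (2 * j) ≤ (2 * j).factorial / t ^ (2 * j)
      * ((Real.exp (t * z) + Real.exp (-t * z)) / 2) := fun z => by
    have := Real.pow_two_mul_div_factorial_le_cosh (t * z) j
    rw [Real.cosh_eq, ← neg_mul, div_le_iff₀ (by positivity), mul_pow] at this
    rw [div_mul_eq_mul_div, le_div_iff₀ (by positivity)]
    linarith
  refine (Finset.expect_le_expect fun s _ => hpt _).trans ?_
  rw [← Finset.mul_expect, ← Finset.expect_div, Finset.expect_add_distrib]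
  have h1 := expect_exp_mean_signSum_sq_le hy hm (t := t) (by rwa [abs_of_pos ht0])
  have h2 := expect_exp_mean_signSum_sq_le hy hm (t := -t) (by rwa [abs_neg, abs_of_pos ht0])
  rw [neg_sq] at h2
  gcongr
  linarith

end

/-! ### Transfer to `q`-wise independent signs and tail bounds. -/

section
variable {Ω : Type*} [MeasurableSpace Ω] {μ : Measure Ω} [IsProbabilityMeasure μ]

theorem ae_eq_or_eq_neg {X : Ω → ℝ} (hX : Measurable X) {c : ℝ} (hc : 0 < c)
    (hp : μ {ω | X ω = c} = 1 / 2) (hn : μ {ω | X ω = -c} = 1 / 2) :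
    ∀ᵐ ω ∂μ, X ω = c ∨ X ω = -c := by
  have hd : Disjoint {ω | X ω = c} {ω | X ω = -c} := by
    rw [Set.disjoint_left]
    intro ω (h1 : X ω = c) (h2 : X ω = -c)
    linarith
  have hm1 : MeasurableSet {ω | X ω = c} := hX (measurableSet_singleton c)
  have hm2 : MeasurableSet {ω | X ω = -c} := hX (measurableSet_singleton (-c))
  have h : μ ({ω | X ω = c} ∪ {ω | X ω = -c}) = 1 := by
    rw [measure_union hd hm2, hp, hn, ENNReal.add_halves]
  exact (prob_compl_eq_zero_iff (hm1.union hm2)).mpr h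

theorem integral_pow_eq_expect_sign {X : Ω → ℝ} (hX : Measurable X) {c : ℝ} (hc : 0 < c)
    (hp : μ {ω | X ω = c} = 1 / 2) (hn : μ {ω | X ω = -c} = 1 / 2) (e : ℕ) :
    ∫ ω, X ω ^ e ∂μ = 𝔼 u : ℤˣ, (c * ((u : ℤ) : ℝ)) ^ e := by
  have hm1 : MeasurableSet {ω | X ω = c} := hX (measurableSet_singleton c)
  have hm2 : MeasurableSet {ω | X ω = -c} := hX (measurableSet_singleton (-c))
  have h : (fun ω => X ω ^ e) =ᵐ[μ] fun ω => {ω | X ω = c}.indicator (fun _ => c ^ e) ω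
      + {ω | X ω = -c}.indicator (fun _ => (-c) ^ e) ω := by
    filter_upwards [ae_eq_or_eq_neg hX hc hp hn] with ω hω
    have hcc : c ≠ -c := by linarith
    rcases hω with h | h <;> simp [Set.indicator, h, hcc, hcc.symm]
  rw [integral_congr_ae h, integral_add ((integrable_const _).indicator hm1)
    ((integrable_const _).indicator hm2), integral_indicator_const _ hm1,
    integral_indicator_const _ hm2, expect_sign, measureReal_def, measureReal_def, hp, hn]
  simp
  ring

variable {ι : Type*} [Fintype ι] {X : ι → Ω → ℝ} {c : ℝ} {q : ℕ}

theorem integrable_prod_pow_of_sign (hX : ∀ a, Measurable (X a)) (hc : 0 < c)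
    (hp : ∀ a, μ {ω | X a ω = c} = 1 / 2) (hn : ∀ a, μ {ω | X a ω = -c} = 1 / 2) (e : ι →₀ ℕ) :
    Integrable (fun ω => ∏ a ∈ e.support, X a ω ^ e a) μ := by
  refine Integrable.of_bound (by fun_prop) (∏ a ∈ e.support, c ^ e a) ?_
  filter_upwards [ae_all_iff.mpr fun a => ae_eq_or_eq_neg (hX a) hc (hp a) (hn a)] with ω hω
  rw [norm_prod]
  refine (Finset.prod_congr rfl fun a _ => ?_).le
  rw [norm_pow]
  rcases hω a with h | h <;> simp [h, abs_of_pos hc]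

variable [DecidableEq ι]

theorem integral_prod_pow_eq_expect_sign (hX : ∀ a, Measurable (X a)) (hc : 0 < c)
    (hp : ∀ a, μ {ω | X a ω = c} = 1 / 2) (hn : ∀ a, μ {ω | X a ω = -c} = 1 / 2)
    (e : ι →₀ ℕ) (hind : iIndepFun (fun (a : e.support) ω => X a ω) μ) :
    ∫ ω, ∏ a ∈ e.support, X a ω ^ e a ∂μ
      = 𝔼 s : ι → ℤˣ, ∏ a ∈ e.support, (c * (((s a : ℤˣ) : ℤ) : ℝ)) ^ e a := by
  have h1 : ∫ ω, ∏ a ∈ e.support, X a ω ^ e a ∂μ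
      = ∏ a ∈ e.support, 𝔼 u : ℤˣ, (c * ((u : ℤ) : ℝ)) ^ e a := by
    have := hind.integral_fun_prod_comp (f := fun (a : e.support) x => x ^ e a)
      (fun a => (hX a).aemeasurable) fun a => by fun_prop
    rw [Finset.prod_coe_sort e.support fun a => ∫ ω, X a ω ^ e a ∂μ] at this
    simp only [fun ω => Finset.prod_coe_sort e.support fun a => X a ω ^ e a] at this
    rw [this]
    exact Finset.prod_congr rfl fun a _ => integral_pow_eq_expect_sign (hX a) hc (hp a) (hn a) _
  have h2 : ∀ f : ι → ℝ, (∀ a, e a = 0 → f a = 1) → ∏ a ∈ e.support, f a = ∏ a, f a :=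
    fun f hf => Finset.prod_subset (Finset.subset_univ _) fun a _ ha =>
      hf a (Finsupp.notMem_support_iff.mp ha)
  rw [h1, h2 _ fun a ha => by simp [ha],
    ← Fintype.expect_pi_prod fun a (u : ℤˣ) => (c * ((u : ℤ) : ℝ)) ^ e a]
  exact Finset.expect_congr rfl fun s _ => (h2 _ fun a ha => by simp [ha]).symm

/-- The expectation of a polynomial of degree at most `q` in `q`-wise independent signs agrees with
its average over all sign patterns. -/
theorem integral_eval_eq_expect_sign (hX : ∀ a, Measurable (X a)) (hc : 0 < c)
    (hp : ∀ a, μ {ω | X a ω = c} = 1 / 2) (hn : ∀ a, μ {ω | X a ω = -c} = 1 / 2)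
    (hind : ∀ S : Finset ι, S.card ≤ q → iIndepFun (fun (a : S) ω => X a ω) μ)
    (p : MvPolynomial ι ℝ) (hq : p.totalDegree ≤ q) :
    Integrable (fun ω => MvPolynomial.eval (fun a => X a ω) p) μ ∧
    ∫ ω, MvPolynomial.eval (fun a => X a ω) p ∂μ
      = 𝔼 s : ι → ℤˣ, MvPolynomial.eval (fun a => c * (((s a : ℤˣ) : ℤ) : ℝ)) p := by
  have hi : ∀ e ∈ p.support,
      Integrable (fun ω => p.coeff e * ∏ a ∈ e.support, X a ω ^ e a) μ :=
    fun e _ => (integrable_prod_pow_of_sign hX hc hp hn e).const_mul _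
  simp only [MvPolynomial.eval_eq]
  refine ⟨integrable_finsetSum _ hi, ?_⟩
  rw [integral_finsetSum _ hi, Finset.expect_sum_comm]
  refine Finset.sum_congr rfl fun e he => ?_
  rw [integral_const_mul, ← Finset.mul_expect]
  have hcard : e.support.card ≤ q := by
    refine le_trans ?_ ((MvPolynomial.le_totalDegree he).trans hq)
    rw [Finsupp.sum, Finset.card_eq_sum_ones]
    exact Finset.sum_le_sum fun a ha =>
      Nat.one_le_iff_ne_zero.mpr (Finsupp.mem_support_iff.mp ha)
  rw [integral_prod_pow_eq_expect_sign hX hc hp hn e (hind _ hcard)]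

end

section
variable {m n q : ℕ} {Ω : Type*} [MeasurableSpace Ω] {μ : Measure Ω} [IsProbabilityMeasure μ]
  {P : Ω → Matrix (Fin m) (Fin n) ℝ}

/-- `‖My‖² - 1` as a polynomial in the entries of the matrix `M`. -/
noncomputable def normSqSubOnePoly (m : ℕ) (y : Fin n → ℝ) :
    MvPolynomial (Fin m × Fin n) ℝ :=
  ∑ i, (∑ j, MvPolynomial.C (y j) * MvPolynomial.X (i, j)) ^ 2 - 1

theorem totalDegree_normSqSubOnePoly_le (y : Fin n → ℝ) :
    (normSqSubOnePoly m y).totalDegree ≤ 2 := by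
  refine (MvPolynomial.totalDegree_sub _ _).trans (max_le ?_ (by simp))
  refine MvPolynomial.totalDegree_finsetSum_le fun i _ => ?_
  refine (MvPolynomial.totalDegree_pow _ _).trans ?_
  have : (∑ j, MvPolynomial.C (y j) * MvPolynomial.X (i, j) :
      MvPolynomial (Fin m × Fin n) ℝ).totalDegree ≤ 1 := by
    refine MvPolynomial.totalDegree_finsetSum_le fun j _ => ?_
    refine (MvPolynomial.totalDegree_mul _ _).trans ?_
    simp
  omega

theorem eval_normSqSubOnePoly (y : Fin n → ℝ) (f : Fin m × Fin n → ℝ) :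
    MvPolynomial.eval f (normSqSubOnePoly m y) = ∑ i, (∑ j, y j * f (i, j)) ^ 2 - 1 := by
  simp [normSqSubOnePoly]

/-- Markov for the `2j`-th moment, whose polynomial has degree at most `4j ≤ q`; the moment may
therefore be computed with independent signs. -/
theorem IsRandomSignMatrix.measureReal_le (hP : IsRandomSignMatrix μ q P) (hm : 0 < m)
    {y : EuclideanSpace ℝ (Fin n)} (hy : ‖y‖ = 1) {j : ℕ} (hq : 4 * j ≤ q) {t η : ℝ} (ht0 : 0 < t)
    (ht : t ≤ m / 8) (hη : 0 < η) :
    μ.real {ω | η ≤ |‖toEuclideanLin (P ω) y‖ ^ 2 - 1|}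
      ≤ (2 * j).factorial / (t * η) ^ (2 * j) * Real.exp (1000 * t ^ 2 / m) := by
  have hm' : (0 : ℝ) < m := by exact_mod_cast hm
  have hc : 0 < 1 / √(m : ℝ) := by positivity
  have hy' : ∑ j, y j ^ 2 = 1 := by
    have := EuclideanSpace.norm_sq_eq y
    rw [hy] at this
    simpa using this.symm
  have hev : ∀ ω, MvPolynomial.eval (fun a : Fin m × Fin n => P ω a.1 a.2)
      (normSqSubOnePoly m y ^ (2 * j)) = (‖toEuclideanLin (P ω) y‖ ^ 2 - 1) ^ (2 * j) := fun ω => by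
    rw [map_pow, eval_normSqSubOnePoly, EuclideanSpace.norm_sq_eq]
    simp [toLpLin_apply, mulVec, dotProduct, mul_comm]
  obtain ⟨hint, heq⟩ := integral_eval_eq_expect_sign (μ := μ)
    (X := fun (a : Fin m × Fin n) ω => P ω a.1 a.2) (q := q) (fun a => hP.measurable_entry a.1 a.2)
    hc (fun a => hP.pos_entry a.1 a.2) (fun a => hP.neg_entry a.1 a.2) hP.indep
    (normSqSubOnePoly m y ^ (2 * j)) (by
      refine (MvPolynomial.totalDegree_pow _ _).trans ?_
      have := totalDegree_normSqSubOnePoly_le (m := m) y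
      nlinarith)
  simp only [hev] at hint heq
  have hexp : 𝔼 s : Fin m × Fin n → ℤˣ, MvPolynomial.eval
        (fun a => 1 / √(m : ℝ) * (((s a : ℤˣ) : ℤ) : ℝ)) (normSqSubOnePoly m y ^ (2 * j))
      = 𝔼 s : Fin m → Fin n → ℤˣ, ((m : ℝ)⁻¹ * ∑ i, signSum y (s i) ^ 2 - 1) ^ (2 * j) := by
    refine Fintype.expect_equiv (Equiv.curry _ _ _) _ _ fun s => ?_
    rw [map_pow, eval_normSqSubOnePoly, Finset.mul_sum]
    congr 2
    refine Finset.sum_congr rfl fun i _ => ?_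
    have : ∑ j, y j * (1 / √(m : ℝ) * (((s (i, j) : ℤˣ) : ℤ) : ℝ))
        = 1 / √(m : ℝ) * signSum y (Equiv.curry _ _ _ s i) := by
      rw [signSum, Finset.mul_sum]
      exact Finset.sum_congr rfl fun j _ => by simp only [Equiv.curry_apply, Function.curry]; ring
    rw [this, mul_pow, div_pow, Real.sq_sqrt hm'.le]
    simp
  rw [hexp] at heq
  have hmom := expect_mean_signSum_sq_pow_le hy' hm ht0 ht j
  rw [← heq] at hmom
  have hmarkov := mul_meas_ge_le_integral_of_nonneg (μ := μ)
    (f := fun ω => (‖toEuclideanLin (P ω) y‖ ^ 2 - 1) ^ (2 * j))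
    (Filter.Eventually.of_forall fun ω => by simp only [pow_mul]; positivity) hint (η ^ (2 * j))
  have hsub : {ω | η ≤ |‖toEuclideanLin (P ω) y‖ ^ 2 - 1|}
      ⊆ {ω | η ^ (2 * j) ≤ (‖toEuclideanLin (P ω) y‖ ^ 2 - 1) ^ (2 * j)} := fun ω hω => by
    have h1 : η ^ (2 * j) ≤ |‖toEuclideanLin (P ω) y‖ ^ 2 - 1| ^ (2 * j) :=
      pow_le_pow_left₀ hη.le hω _
    rwa [(even_two_mul j).pow_abs] at h1
  have h2 : η ^ (2 * j) * μ.real {ω | η ≤ |‖toEuclideanLin (P ω) y‖ ^ 2 - 1|}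
      ≤ (2 * j).factorial / t ^ (2 * j) * Real.exp (1000 * t ^ 2 / m) :=
    (mul_le_mul_of_nonneg_left (measureReal_mono hsub) (by positivity)).trans
      (hmarkov.trans hmom)
  rw [mul_comm, ← le_div_iff₀ (by positivity)] at h2
  refine h2.trans_eq ?_
  rw [mul_pow]
  field_simp

theorem IsRandomSignMatrix.measureReal_norm_sq_le (hP : IsRandomSignMatrix μ q P) (hm : 0 < m)
    (z : EuclideanSpace ℝ (Fin n)) {j : ℕ} (hq : 4 * j ≤ q) {t η : ℝ} (ht0 : 0 < t)
    (ht : t ≤ m / 8) (hη : 0 < η) :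
    μ.real {ω | η * ‖z‖ ^ 2 < |‖toEuclideanLin (P ω) z‖ ^ 2 - ‖z‖ ^ 2|}
      ≤ (2 * j).factorial / (t * η) ^ (2 * j) * Real.exp (1000 * t ^ 2 / m) := by
  -- The strict inequality makes the event empty at `z = 0`; otherwise rescale to a unit vector.
  rcases eq_or_ne z 0 with rfl | hz
  · simp only [map_zero, norm_zero]
    simp
    positivity
  have hz' : 0 < ‖z‖ := norm_pos_iff.mpr hz
  refine le_trans (measureReal_mono fun ω hω => ?_)
    (hP.measureReal_le hm (y := ‖z‖⁻¹ • z) (norm_smul_inv_norm hz) hq ht0 ht hη)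
  simp only [Set.mem_ofPred_eq, map_smul, norm_smul, norm_inv, norm_norm] at hω ⊢
  have : (‖z‖⁻¹ * ‖toEuclideanLin (P ω) z‖) ^ 2 - 1
      = (‖toEuclideanLin (P ω) z‖ ^ 2 - ‖z‖ ^ 2) / ‖z‖ ^ 2 := by field_simp
  rw [this, abs_div, abs_of_pos (pow_pos hz' 2), le_div_iff₀ (by positivity)]
  exact hω.le

end

/-! ### Nets and quadratic forms. -/

section
variable {E F : Type*} [NormedAddCommGroup E] [InnerProductSpace ℝ E]
  [NormedAddCommGroup F] [InnerProductSpace ℝ F]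

/-- Take a `1`-separated subset of the radius-`2` ball of maximal size. The Besicovitch bound makes
that size finite, and a point far from the set could be added to it. -/
theorem exists_finset_net (E : Type*) [NormedAddCommGroup E] [InnerProductSpace ℝ E]
    [FiniteDimensional ℝ E] : ∃ N : Finset E, N.card ≤ 5 ^ Module.finrank ℝ E ∧
      (∀ c ∈ N, ‖c‖ ≤ 2) ∧ ∀ x : E, ‖x‖ ≤ 2 → ∃ c ∈ N, ‖x - c‖ ≤ 1 := by
  classical
  let Sep : Finset E → Prop := fun s =>
    (∀ c ∈ s, ‖c‖ ≤ 2) ∧ ∀ c ∈ s, ∀ d ∈ s, c ≠ d → 1 ≤ ‖c - d‖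
  have hb : ∀ s, Sep s → s.card ≤ 5 ^ Module.finrank ℝ E := fun s hs =>
    Besicovitch.card_le_of_separated s hs.1 hs.2
  let p : ℕ → Prop := fun k => ∃ s, Sep s ∧ s.card = k
  have hp0 : p 0 := ⟨∅, ⟨by simp, by simp⟩, rfl⟩
  obtain ⟨N, hN, hcard⟩ : p (Nat.findGreatest p (5 ^ Module.finrank ℝ E)) :=
    Nat.findGreatest_spec (Nat.zero_le _) hp0
  refine ⟨N, hb N hN, hN.1, fun x hx => ?_⟩
  by_contra! hfar
  have hxN : x ∉ N := fun h => by
    have := hfar x h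
    simp at this
    linarith
  have hSep : Sep (insert x N) := by
    refine ⟨fun c hc => ?_, fun c hc d hd hcd => ?_⟩
    · rcases Finset.mem_insert.mp hc with rfl | h
      exacts [hx, hN.1 c h]
    · rcases Finset.mem_insert.mp hc with rfl | h <;> rcases Finset.mem_insert.mp hd with rfl | h'
      · exact absurd rfl hcd
      · exact (hfar d h').le
      · rw [norm_sub_rev]; exact (hfar c h).le
      · exact hN.2 c h d h' hcd
  have := Nat.le_findGreatest (P := p) (hb _ hSep) ⟨_, hSep, rfl⟩
  rw [Finset.card_insert_of_notMem hxN] at this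
  omega

variable {N : Finset E}

/-- For a unit vector `x`, approximate `2 • x` by a net point within distance `1`. Halving gives
`‖f‖ ≤ (η + ‖f‖) / 2`, and the error term is absorbed. -/
theorem ContinuousLinearMap.opNorm_le_of_net (hN : ∀ x : E, ‖x‖ ≤ 2 → ∃ c ∈ N, ‖x - c‖ ≤ 1)
    (f : E →L[ℝ] ℝ) {η : ℝ} (h : ∀ c ∈ N, |f c| ≤ η) : ‖f‖ ≤ η := by
  have hη : 0 ≤ η := by
    obtain ⟨c, hc, -⟩ := hN 0 (by simp)
    exact (abs_nonneg _).trans (h c hc)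
  have h1 : ‖f‖ ≤ (η + ‖f‖) / 2 := by
    refine f.opNorm_le_of_unit_norm (by positivity) fun x hx => ?_
    obtain ⟨c, hc, hxc⟩ := hN ((2 : ℝ) • x) (by rw [norm_smul, hx]; norm_num)
    have h2 := f.le_opNorm ((2 : ℝ) • x - c)
    have h3 : f x = (f c + f ((2 : ℝ) • x - c)) / 2 := by
      rw [map_sub, map_smul, smul_eq_mul]; ring
    rw [h3, norm_div, Real.norm_ofNat]
    gcongr
    refine (norm_add_le _ _).trans (add_le_add (h c hc) (h2.trans ?_))
    exact mul_le_of_le_one_right (norm_nonneg _) hxc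
  linarith

theorem ContinuousLinearMap.abs_apply_apply_le_of_net
    (hN : ∀ x : E, ‖x‖ ≤ 2 → ∃ c ∈ N, ‖x - c‖ ≤ 1)
    (B : E →L[ℝ] E →L[ℝ] ℝ) {η : ℝ} (h : ∀ c ∈ N, ∀ c' ∈ N, |B c c'| ≤ η) (x y : E) :
    |B x y| ≤ η * ‖x‖ * ‖y‖ := by
  have h1 : ∀ c ∈ N, |B c y| ≤ η * ‖y‖ := fun c hc =>
    ((B c).le_opNorm y).trans (by gcongr; exact opNorm_le_of_net hN (B c) (h c hc))
  have h2 := opNorm_le_of_net hN (B.flip y) h1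
  calc |B x y| ≤ ‖B.flip y‖ * ‖x‖ := (B.flip y).le_opNorm x
    _ ≤ η * ‖y‖ * ‖x‖ := by gcongr
    _ = _ := by ring

/-- By polarisation, the defect form `B` at `c, c'` is a quarter of the difference of the defects at
`c + c'` and `c - c'`. The parallelogram law bounds the squared norms of these by `16` in total,
whence `|B c c'| ≤ η`. -/
theorem ContinuousLinearMap.abs_norm_sq_sub_le_of_net
    (hN2 : ∀ c ∈ N, ‖c‖ ≤ 2) (hN : ∀ x : E, ‖x‖ ≤ 2 → ∃ c ∈ N, ‖x - c‖ ≤ 1)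
    (T : E →L[ℝ] F) {η : ℝ} (hη : 0 ≤ η)
    (hadd : ∀ c ∈ N, ∀ c' ∈ N, |‖T (c + c')‖ ^ 2 - ‖c + c'‖ ^ 2| ≤ η / 4 * ‖c + c'‖ ^ 2)
    (hsub : ∀ c ∈ N, ∀ c' ∈ N, |‖T (c - c')‖ ^ 2 - ‖c - c'‖ ^ 2| ≤ η / 4 * ‖c - c'‖ ^ 2) (x : E) :
    |‖T x‖ ^ 2 - ‖x‖ ^ 2| ≤ η * ‖x‖ ^ 2 := by
  let B : E →L[ℝ] E →L[ℝ] ℝ := (innerSL ℝ).bilinearComp T T - innerSL ℝ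
  have hB : ∀ x y, B x y = inner ℝ (T x) (T y) - inner ℝ x y := fun x y => rfl
  have h : ∀ c ∈ N, ∀ c' ∈ N, |B c c'| ≤ η := fun c hc c' hc' => by
    have h1 := abs_le.mp (hadd c hc c' hc')
    have h2 := abs_le.mp (hsub c hc c' hc')
    have p1 := norm_add_sq_real c c'
    have p2 := norm_sub_sq_real c c'
    have p3 := norm_add_sq_real (T c) (T c')
    have p4 := norm_sub_sq_real (T c) (T c')
    rw [← map_add] at p3
    rw [← map_sub] at p4
    have hn : ‖c + c'‖ ^ 2 + ‖c - c'‖ ^ 2 ≤ 16 := by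
      have := hN2 c hc
      have := hN2 c' hc'
      nlinarith [norm_nonneg c, norm_nonneg c']
    have hn' := mul_le_mul_of_nonneg_left hn hη
    rw [hB, abs_le]
    constructor <;> linarith
  have := abs_apply_apply_le_of_net hN B h x x
  rw [hB, real_inner_self_eq_norm_sq, real_inner_self_eq_norm_sq] at this
  linarith

end

/-! ### The random embedding and the main theorem. -/

/-- Passing to squares loses nothing, as `(1 - ε)² ≤ 1 - ε` and `1 + ε ≤ (1 + ε)²`. -/
theorem isSubspaceEmbedding_of_abs_norm_sq_sub_le {m n d : ℕ} {ε : ℝ} (hε : 0 < ε) (hε1 : ε < 1)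
    {P : Matrix (Fin m) (Fin n) ℝ} {A : Matrix (Fin n) (Fin d) ℝ}
    (h : ∀ x ∈ LinearMap.range (toEuclideanLin A),
      |‖toEuclideanLin P x‖ ^ 2 - ‖x‖ ^ 2| ≤ ε * ‖x‖ ^ 2) : IsSubspaceEmbedding ε P A := by
  intro x
  have h1 := abs_le.mp (h _ ⟨x, rfl⟩)
  rw [Matrix.toEuclideanLin_mul, LinearMap.comp_apply]
  set a := ‖toEuclideanLin A x‖
  have ha : 0 ≤ a := norm_nonneg _
  constructor
  · refine le_of_sq_le_sq ?_ (norm_nonneg _)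
    nlinarith [mul_nonneg (mul_nonneg hε.le (sub_nonneg.mpr hε1.le)) (sq_nonneg a)]
  · refine le_of_sq_le_sq ?_ (by positivity)
    nlinarith [mul_nonneg hε.le (sq_nonneg a), mul_nonneg (mul_nonneg hε.le hε.le) (sq_nonneg a)]

/-- The union bound over `2 * 25 ^ d` events with moment order `2d`. The choice of `t` gives `t * (ε
/ 4) = 60 d`, so the moment ratio is at most `900⁻ᵈ`; and `57600000 = 1000 * 240 ^ 2` keeps the
exponential below `e ^ d`. Then `25 e² / 900 ≤ 1 / 4` leaves room for the factor `2`. -/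
theorem two_mul_pow_mul_tail_le {d : ℕ} (hd : 0 < d) {ε t M : ℝ} (hε : 0 < ε)
    (ht : t = 240 * d / ε) (hM : 57600000 * d / ε ^ 2 ≤ M) :
    2 * (25 : ℝ) ^ d * ((2 * d).factorial / (t * (ε / 4)) ^ (2 * d) * Real.exp (1000 * t ^ 2 / M))
      ≤ Real.exp (-(d : ℝ)) := by
  have hd' : (0 : ℝ) < d := by exact_mod_cast hd
  have hM0 : 0 < M := lt_of_lt_of_le (by positivity) hM
  have h1 : t * (ε / 4) = 2 * d * 30 := by rw [ht]; field_simp; norm_num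
  have h2 : ((2 * d).factorial : ℝ) / (t * (ε / 4)) ^ (2 * d) ≤ (1 / 900) ^ d := by
    have hf : ((2 * d).factorial : ℝ) ≤ (2 * d) ^ (2 * d) := by
      exact_mod_cast Nat.factorial_le_pow (2 * d)
    rw [h1, mul_pow, div_le_iff₀ (by positivity), pow_mul (30 : ℝ), div_pow, one_pow]
    norm_num
    field_simp
    exact_mod_cast Nat.factorial_le_pow (2 * d)
  have h3 : Real.exp (1000 * t ^ 2 / M) ≤ Real.exp 1 ^ d := by
    rw [Real.exp_one_pow]
    apply Real.exp_le_exp.mpr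
    rw [div_le_iff₀ hM0]
    refine le_trans (le_of_eq ?_) (mul_le_mul_of_nonneg_left hM hd'.le)
    rw [ht]
    ring
  have he : Real.exp 1 ^ d * Real.exp (-(d : ℝ)) = 1 := by
    rw [Real.exp_one_pow, ← Real.exp_add]; simp
  have h4 : 2 * ((25 : ℝ) * (1 / 900) * (Real.exp 1) * (Real.exp 1)) ^ d ≤ 1 := by
    have h5 : (25 : ℝ) * (1 / 900) * (Real.exp 1) * (Real.exp 1) ≤ 1 / 4 := by
      nlinarith [Real.exp_one_lt_d9, Real.exp_pos 1]
    calc 2 * ((25 : ℝ) * (1 / 900) * (Real.exp 1) * (Real.exp 1)) ^ d ≤ 2 * (1 / 4) ^ d := by gcongr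
      _ ≤ 2 * (1 / 4) ^ 1 := by
        gcongr ?_ * ?_
        exact pow_le_pow_of_le_one (by norm_num) (by norm_num) hd
      _ ≤ 1 := by norm_num
  calc _ ≤ 2 * (25 : ℝ) ^ d * ((1 / 900) ^ d * Real.exp 1 ^ d) := by gcongr
    _ = 2 * (25 : ℝ) ^ d * ((1 / 900) ^ d * Real.exp 1 ^ d)
          * (Real.exp 1 ^ d * Real.exp (-(d : ℝ))) := by rw [he, mul_one]
    _ = 2 * ((25 : ℝ) * (1 / 900) * (Real.exp 1) * (Real.exp 1)) ^ d * Real.exp (-(d : ℝ)) := by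
        simp only [mul_pow]; ring
    _ ≤ 1 * Real.exp (-(d : ℝ)) := by gcongr
    _ = _ := one_mul _

/-- Subadditivity suffices, so measurability of the good event never has to be shown. -/
theorem one_sub_le_measureReal_of_compl_subset {Ω : Type*} [MeasurableSpace Ω] {μ : Measure Ω}
    [IsProbabilityMeasure μ] {s b : Set Ω} (h : bᶜ ⊆ s) {δ : ℝ} (hb : μ.real b ≤ δ) :
    1 - δ ≤ μ.real s := by
  have h1 : μ.real (Set.univ : Set Ω) ≤ μ.real s + μ.real b :=
    (measureReal_mono fun ω _ => by
      by_cases hω : ω ∈ b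
      exacts [Or.inr hω, Or.inl (h hω)]).trans (measureReal_union_le s b)
  rw [probReal_univ] at h1
  linarith

theorem IsRandomSignMatrix.exists_isSubspaceEmbedding {m n d q : ℕ} {ε : ℝ} (hε : 0 < ε)
    (hε1 : ε < 1) (hm : 57600000 * d / ε ^ 2 ≤ (m : ℝ)) (hq : 4 * d ≤ q)
    (A : Matrix (Fin n) (Fin d) ℝ) {Ω : Type*} [MeasurableSpace Ω] {μ : Measure Ω}
    [IsProbabilityMeasure μ] {P : Ω → Matrix (Fin m) (Fin n) ℝ} (hP : IsRandomSignMatrix μ q P) :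
    ∃ b : Set Ω, μ.real b ≤ Real.exp (-(d : ℝ)) ∧ ∀ ω ∉ b, IsSubspaceEmbedding ε (P ω) A := by
  -- For `d = 0` the allowed failure probability is `1`.
  rcases Nat.eq_zero_or_pos d with rfl | hd
  · exact ⟨Set.univ, by simp, by simp⟩
  have hd' : (0 : ℝ) < d := by exact_mod_cast hd
  have hm0 : (0 : ℝ) < m := lt_of_lt_of_le (by positivity) hm
  have hm0' : 0 < m := by exact_mod_cast hm0
  set t : ℝ := 240 * d / ε with ht
  have ht0 : 0 < t := by positivity
  have htm : t ≤ m / 8 := by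
    have : t ≤ 57600000 * d / ε ^ 2 / 8 := by
      rw [ht, div_div, div_le_div_iff₀ hε (by positivity)]
      nlinarith [mul_pos hd' hε, mul_pos (mul_pos hd' hε) (sub_pos.mpr hε1)]
    linarith
  let U := LinearMap.range (toEuclideanLin A)
  have hU : Module.finrank ℝ U ≤ d := by
    simpa using LinearMap.finrank_range_le (toEuclideanLin A)
  obtain ⟨N, hNcard, hN2, hN⟩ := exists_finset_net U
  let bad : EuclideanSpace ℝ (Fin n) → Set Ω := fun z =>
    {ω | ε / 4 * ‖z‖ ^ 2 < |‖toEuclideanLin (P ω) z‖ ^ 2 - ‖z‖ ^ 2|}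
  set τ : ℝ := (2 * d).factorial / (t * (ε / 4)) ^ (2 * d) * Real.exp (1000 * t ^ 2 / m) with hτ
  have hτ0 : 0 ≤ τ := by positivity
  have hbad : ∀ z, μ.real (bad z) ≤ τ := fun z =>
    hP.measureReal_norm_sq_le hm0' z hq ht0 htm (by positivity)
  -- Polarisation needs the sum and the difference of each pair of net points, which is the source
  -- of the factor `2`.
  refine ⟨⋃ p ∈ N ×ˢ N, (bad (p.1 + p.2 : U) ∪ bad (p.1 - p.2 : U)), ?_, fun ω hω => ?_⟩
  · refine (measureReal_biUnion_finset_le _ _).trans ?_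
    refine le_trans ?_ (two_mul_pow_mul_tail_le hd hε ht hm)
    rw [← hτ]
    calc ∑ p ∈ N ×ˢ N, μ.real (bad (p.1 + p.2 : U) ∪ bad (p.1 - p.2 : U))
        ≤ ∑ p ∈ N ×ˢ N, (τ + τ) := Finset.sum_le_sum fun p _ =>
          (measureReal_union_le _ _).trans (add_le_add (hbad _) (hbad _))
      _ = 2 * ((N.card : ℝ) * N.card) * τ := by
          rw [Finset.sum_const, Finset.card_product, nsmul_eq_mul]; push_cast; ring
      _ ≤ 2 * (25 : ℝ) ^ d * τ := by
          have h1 : (N.card : ℝ) ≤ 5 ^ d := by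
            exact_mod_cast hNcard.trans (Nat.pow_le_pow_right (by norm_num) hU)
          have h2 : (25 : ℝ) ^ d = 5 ^ d * 5 ^ d := by rw [← mul_pow]; norm_num
          rw [h2]
          gcongr
  · simp only [Set.mem_iUnion, not_exists, Set.mem_union, not_or] at hω
    refine isSubspaceEmbedding_of_abs_norm_sq_sub_le hε hε1 fun x hx => ?_
    let T : U →L[ℝ] EuclideanSpace ℝ (Fin m) :=
      LinearMap.toContinuousLinearMap (toEuclideanLin (P ω) ∘ₗ U.subtype)
    exact T.abs_norm_sq_sub_le_of_net hN2 hN hε.le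
      (fun c hc c' hc' => not_lt.mp (hω (c, c') (Finset.mk_mem_product hc hc')).1)
      (fun c hc c' hc' => not_lt.mp (hω (c, c') (Finset.mk_mem_product hc hc')).2) ⟨x, hx⟩

theorem mainTheorem5 :
    (∀ ε₀ : ℝ, 0 < ε₀ → ε₀ < 1 → ∃ C : ℝ, 0 < C ∧
      ∀ (m n d k : ℕ) (ε : ℝ), 0 < ε → ε ≤ ε₀ →
      ∀ (A : Matrix (Fin n) (Fin d) ℝ) (P : Matrix (Fin m) (Fin n) ℝ),
        IsSubspaceEmbedding ε P A →
        ∀ V : Matrix (Fin d) (Fin k) ℝ, IsTopRightSingularVectors (P * A) V →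
          ‖A - A * V * Vᵀ‖ ≤ (1 + C * ε) * lowRankDist k A) ∧
    (∃ (K : ℝ) (L : ℕ), 0 < K ∧ 0 < L ∧
      ∀ ε₀ : ℝ, 0 < ε₀ → ε₀ < 1 → ∃ C : ℝ, 0 < C ∧
      ∀ (m n d q : ℕ) (ε : ℝ), 0 < ε → ε ≤ ε₀ → K * d / ε ^ 2 ≤ m → L * d ≤ q →
      ∀ (A : Matrix (Fin n) (Fin d) ℝ)
        (Ω : Type*) [MeasurableSpace Ω] (μ : Measure Ω) [IsProbabilityMeasure μ]
        (P : Ω → Matrix (Fin m) (Fin n) ℝ), IsRandomSignMatrix μ q P →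
        1 - Real.exp (-(d : ℝ)) ≤ μ.real {ω | IsSubspaceEmbedding ε (P ω) A ∧
          ∀ (k : ℕ) (V : Matrix (Fin d) (Fin k) ℝ), IsTopRightSingularVectors (P ω * A) V →
            ‖A - A * V * Vᵀ‖ ≤ (1 + C * ε) * lowRankDist k A}) := by
  refine ⟨fun ε₀ _ h1 => ⟨2 / (1 - ε₀), div_pos two_pos (sub_pos.mpr h1), ?_⟩,
    57600000, 4, by norm_num, by norm_num, fun ε₀ _ h1 =>
      ⟨2 / (1 - ε₀), div_pos two_pos (sub_pos.mpr h1), ?_⟩⟩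
  · intro m n d k ε hε hεε₀ A P hP V hV
    exact hP.norm_sub_le hε hεε₀ h1 hV
  · intro m n d q ε hε hεε₀ hm hq A Ω _ μ _ P hP
    obtain ⟨b, hb, hgood⟩ := hP.exists_isSubspaceEmbedding hε (hεε₀.trans_lt h1) hm hq A
    refine one_sub_le_measureReal_of_compl_subset (b := b) (fun ω hω => ?_) hb
    -- Part (1) is deterministic, so one good event serves all `k` and `V` with no further union
    -- bound.
    exact ⟨hgood ω hω, fun k V hV => (hgood ω hω).norm_sub_le hε hεε₀ h1 hV⟩
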